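/- Let $\Gamma$ be a countable group. A measure preserving action $\boldsymbol{a}=\Gamma\curvearrowright^a(X,\mu)$ is a Borel action of $\Gamma$ on a standard Borel space $X$ preserving a Borel probability measure $\mu$. It is weakly contained in a measure preserving action $\boldsymbol{b}=\Gamma\curvearrowright^b(Y,\nu)$, written $\boldsymbol{a}\prec\boldsymbol{b}$, if for every finite Borel partition $A_0,\dots,A_{k-1}$ of $X$, every finite $F\subseteq\Gamma$ and every $\epsilon>0$ there is a Borel partition $B_0,\dots,B_{k-1}$ of $Y$ with $$|\mu(\gamma^aA_i\cap A_j)-\nu(\gamma^bB_i\cap B_j)|<\epsilon\quad\text{for all }\gamma\in F,\ 0\le i,j<k$$ (pieces of partitions may be empty). Theorem. Let $\boldsymbol{d}=\Gamma\curvearrowright^d(Y,\nu)$ be a measure preserving action and let $\boldsymbol{a}=\Gamma\curvearrowright^a(X,\mu)$ be an ergodic measure preserving action that is weakly contained in $\boldsymbol{d}$. (1) Let $\pi:(Y,\nu)\to(Z,\eta)$ be a factor map from $\boldsymbol{d}$ onto an identity action of $\Gamma$ on a standard probability space $(Z,\eta)$, i.e. $\pi$ is Borel, $\pi_*\nu=\eta$,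 and $\pi(\gamma^dy)=\pi(y)$ for every $\gamma\in\Gamma$ and $\nu$-almost every $y$. Let $\nu=\int_Z\nu_z\,d\eta(z)$ be the disintegration of $\nu$ with respect to $\pi$ (a measurable family of Borel probability measures with $\nu_z(\pi^{-1}(\{z\}))=1$ for $\eta$-almost every $z$). Then for $\eta$-almost every $z\in Z$ the measure $\nu_z$ is $\Gamma$-invariant and $\boldsymbol{a}$ is weakly contained in $\boldsymbol{d}_z=\Gamma\curvearrowright^d(Y,\nu_z)$. (2) In particular, $\boldsymbol{a}$ is weakly contained in almost every ergodic component of $\boldsymbol{d}$: if $(\nu_y)_{y\in Y}$ is the disintegration of $\nu$ over the $\sigma$-algebra of $\Gamma$-invariant Borel subsets of $Y$ (the regular conditional probability of $\nu$ given that $\sigma$-algebra), then for $\nu$-almost every $y\in Y$ the measure $\nu_y$ is $\Gamma$-invariant and $\boldsymbol{a}$ is weakly contained in $\Gamma\curvearrowright^d(Y,\nu_y)$. -/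

import Mathlib

open MeasureTheory ProbabilityTheory
open scoped Pointwise

/-- A Borel partition of `X` into `k` pieces indexed by `Fin k` (pieces may be empty, so that
partitions into `k` pieces are the same as Borel functions `X → Fin k`). -/
structure IsBorelPartition {X : Type*} [MeasurableSpace X] {k : ℕ} (A : Fin k → Set X) :
    Prop where
  measurableSet : ∀ i, MeasurableSet (A i)
  pairwise_disjoint : Pairwise fun i j => Disjoint (A i) (A j)
  iUnion_eq : ⋃ i, A i = Set.univ

/-- Weak containment of the action of `Γ` on `(X, μ)` in the action of `Γ` on `(Y, ν)`. -/
def WeaklyContained (Γ : Type*) [Group Γ]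
    {X : Type*} [MeasurableSpace X] [MulAction Γ X] (μ : Measure X)
    {Y : Type*} [MeasurableSpace Y] [MulAction Γ Y] (ν : Measure Y) : Prop :=
  ∀ (k : ℕ) (A : Fin k → Set X), IsBorelPartition A →
    ∀ (F : Finset Γ) (ε : ℝ), 0 < ε →
      ∃ B : Fin k → Set Y, IsBorelPartition B ∧
        ∀ γ ∈ F, ∀ i j : Fin k,
          |μ.real ((γ • A i) ∩ A j) - ν.real ((γ • B i) ∩ B j)| < ε

/-- `π` is a factor map from the action of `Γ` on `(Y, ν)` onto the action of `Γ` on `(Z, η)`: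
it is measurable, pushes `ν` forward to `η`, and each `γ : Γ` commutes with it almost everywhere. -/
structure IsFactorMap (Γ : Type*) [Group Γ]
    {Y : Type*} [MeasurableSpace Y] [MulAction Γ Y] (ν : Measure Y)
    {Z : Type*} [MeasurableSpace Z] [MulAction Γ Z] (η : Measure Z) (π : Y → Z) : Prop where
  measurePreserving : MeasurePreserving π ν η
  ae_equivariant : ∀ γ : Γ, ∀ᵐ y ∂ν, π (γ • y) = γ • π y

/-- `z ↦ κ z` is a disintegration of `ν` with respect to `π : (Y, ν) → (Z, η)`: it is a measurable
family of probability measures, `κ z` is concentrated on the fibre `π ⁻¹' {z}` for `η`-almost every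
`z`, and `ν = ∫ κ z dη(z)`. -/
structure IsDisintegration {Y : Type*} [MeasurableSpace Y] (ν : Measure Y)
    {Z : Type*} [MeasurableSpace Z] (η : Measure Z) (π : Y → Z) (κ : Kernel Z Y) : Prop where
  isMarkovKernel : IsMarkovKernel κ
  ae_fibre : ∀ᵐ z ∂η, ∀ᵐ y ∂(κ z), π y = z
  measure_eq : ∀ s : Set Y, MeasurableSet s → ν s = ∫⁻ z, κ z s ∂η

/-- The σ-algebra of measurable subsets of `Y` that are invariant under the action of `Γ`. -/
@[reducible]
def invariantSigmaAlgebra (Γ : Type*) [Group Γ] (Y : Type*) [MeasurableSpace Y] [MulAction Γ Y] :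
    MeasurableSpace Y where
  MeasurableSet' s := MeasurableSet s ∧ ∀ γ : Γ, (fun y => γ • y) ⁻¹' s = s
  measurableSet_empty := ⟨MeasurableSet.empty, fun _ => rfl⟩
  measurableSet_compl s hs := ⟨hs.1.compl, fun γ => by rw [Set.preimage_compl, hs.2 γ]⟩
  measurableSet_iUnion f hf :=
    ⟨MeasurableSet.iUnion fun i => (hf i).1, fun γ => by
      rw [Set.preimage_iUnion]; exact Set.iUnion_congr fun i => (hf i).2 γ⟩

/-- The ergodic component through `y` of the action of `Γ` on the standard probability space
`(Y, ν)`: the measure at `y` of the disintegration of `ν` over the σ-algebra of invariant sets,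
i.e. the regular conditional probability of `ν` given that σ-algebra. -/
noncomputable def ergodicComponent (Γ : Type*) [Group Γ] {Y : Type*} [MeasurableSpace Y]
    [StandardBorelSpace Y] [MulAction Γ Y] (ν : Measure Y) [IsFiniteMeasure ν] (y : Y) :
    Measure Y :=
  condExpKernel ν (invariantSigmaAlgebra Γ Y) y

open Filter Topology

/-! Weak containment only controls correlations averaged over `ν`; ergodicity of `μ` prevents these
from varying along the decomposition. By the mean ergodic theorem a weighted average of translates
of an observable `ψ ∘ p` is `L²`-close to its mean `m`. The squared error is a combination of pair
correlations, so it stays small for models `q n` of `p` on `(Y, ν)`. Jensen's inequality over each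
invariant `κ z` then makes `∫ ψ (q n y) ∂(κ z)` converge to `m` in `L²(η)`
(`tendsto_integral_sq_integral_kernel_sub`).

This controls distributions of single observables, not correlations over `κ z`. In
`ae_exists_isBorelPartition`, `p` therefore also records the labels of the points `γ⁻¹ • x`, which
turns correlations into one-point statistics. A countable family of partitions then gives one null
set for all of them. Both decompositions reduce to `ae_weaklyContained_of_bind_eq`, which needs
invariant pieces, not ergodic ones. -/

/-! ### Partitions as finite-valued observables, and their correlations. -/

lemma isBorelPartition_preimage_singleton {X : Type*} [MeasurableSpace X] {k : ℕ}
    {p : X → Fin k} (hp : Measurable p) : IsBorelPartition fun i => p ⁻¹' {i} where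
  measurableSet i := hp (measurableSet_singleton i)
  pairwise_disjoint i j hij := by
    refine Set.disjoint_left.2 fun x hx hx' => hij ?_
    simp only [Set.mem_preimage, Set.mem_singleton_iff] at hx hx'
    rw [← hx, hx']
  iUnion_eq := by ext x; simp

lemma IsBorelPartition.exists_measurable {X : Type*} [MeasurableSpace X] {k : ℕ}
    {A : Fin k → Set X} (hA : IsBorelPartition A) :
    ∃ p : X → Fin k, Measurable p ∧ ∀ i, p ⁻¹' {i} = A i := by
  have h : ∀ x, ∃ i, x ∈ A i := fun x => by
    simpa using (hA.iUnion_eq ▸ Set.mem_univ x : x ∈ ⋃ i, A i)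
  choose p hp using h
  have hpA : ∀ i, p ⁻¹' {i} = A i := fun i => by
    ext x
    refine ⟨fun hx => ?_, fun hx => ?_⟩
    · have := hp x
      rwa [show p x = i from hx] at this
    · by_contra hne
      exact Set.disjoint_left.1 (hA.pairwise_disjoint hne) (hp x) hx
  exact ⟨p, measurable_to_countable' fun i => hpA i ▸ hA.measurableSet i, hpA⟩

lemma WeaklyContained.exists_seq_tendsto {Γ : Type*} [Group Γ] [Countable Γ]
    {X : Type*} [MeasurableSpace X] [MulAction Γ X] {μ : Measure X}
    {Y : Type*} [MeasurableSpace Y] [MulAction Γ Y] {ν : Measure Y}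
    (h : WeaklyContained Γ μ ν) {ι : Type*} [Finite ι] [MeasurableSpace ι]
    [MeasurableSingletonClass ι] {p : X → ι} (hp : Measurable p) :
    ∃ q : ℕ → Y → ι, (∀ n, Measurable (q n)) ∧ ∀ (g : Γ) (i j : ι),
      Tendsto (fun n => ν.real ((g • (q n ⁻¹' {i})) ∩ q n ⁻¹' {j})) atTop
        (𝓝 (μ.real ((g • (p ⁻¹' {i})) ∩ p ⁻¹' {j}))) := by
  obtain ⟨k, ⟨e⟩⟩ := Finite.exists_equiv_fin ι
  obtain ⟨F, hF⟩ := Filter.exists_seq_tendsto (atTop : Filter (Finset Γ))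
  have hpA := isBorelPartition_preimage_singleton ((measurable_of_finite e).comp hp)
  choose B hB hBε using fun n : ℕ => h k _ hpA (F n) (1 / (n + 1 : ℝ)) (by positivity)
  choose q hq hqB using fun n => (hB n).exists_measurable
  refine ⟨fun n => e.symm ∘ q n, fun n => (measurable_of_finite _).comp (hq n),
    fun g i j => ?_⟩
  rw [tendsto_iff_dist_tendsto_zero]
  refine squeeze_zero' (Eventually.of_forall fun _ => dist_nonneg) ?_
    tendsto_one_div_add_atTop_nhds_zero_nat
  -- The finite sets `F n` exhaust the countable group, so each `g` is eventually controlled with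
  -- error `1 / (n + 1)`.
  filter_upwards [hF.eventually_ge_atTop {g}] with n hn
  have hset : ∀ i, (e.symm ∘ q n) ⁻¹' {i} = B n (e i) := fun i => by
    rw [← hqB]; ext y; simp [Equiv.symm_apply_eq]
  have hset' : ∀ i, p ⁻¹' {i} = (e ∘ p) ⁻¹' {e i} := fun i => by ext; simp
  rw [hset, hset, hset', hset' j, Real.dist_eq, abs_sub_comm]
  exact (hBε n g (Finset.singleton_subset_iff.1 hn) (e i) (e j)).le

/-- Invariance lets `h` be moved to the identity, so only the relative position `h * g⁻¹` matters.
-/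
lemma integral_correlation {Γ : Type*} [Group Γ] {Y : Type*} [MeasurableSpace Y] [MulAction Γ Y]
    [MeasurableConstSMul Γ Y] (ν : Measure Y) [IsFiniteMeasure ν] [SMulInvariantMeasure Γ Y ν]
    {ι : Type*} [Fintype ι] [MeasurableSpace ι] [MeasurableSingletonClass ι]
    {q : Y → ι} (hq : Measurable q) (φ : ι → ι → ℝ) (g h : Γ) :
    ∫ y, φ (q (g • y)) (q (h • y)) ∂ν =
      ∑ i, ∑ j, φ i j * ν.real (((h * g⁻¹) • (q ⁻¹' {i})) ∩ q ⁻¹' {j}) := by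
  classical
  have hm : ∀ i j, MeasurableSet (((h * g⁻¹) • (q ⁻¹' {i})) ∩ q ⁻¹' {j}) := fun i j =>
    ((hq (measurableSet_singleton i)).const_smul _).inter (hq (measurableSet_singleton j))
  have h1 : ∫ y, φ (q (g • y)) (q (h • y)) ∂ν
      = ∫ y, φ (q ((g * h⁻¹) • y)) (q y) ∂ν := by
    rw [← (measurePreserving_smul h ν).integral_comp (MeasurableEquiv.smul h).measurableEmbedding
      fun y => φ (q ((g * h⁻¹) • y)) (q y)]
    simp [smul_smul]
  have h2 : ∀ y, φ (q ((g * h⁻¹) • y)) (q y) = ∑ i, ∑ j,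
      (((h * g⁻¹) • (q ⁻¹' {i})) ∩ q ⁻¹' {j}).indicator (fun _ => φ i j) y := fun y => by
    rw [Finset.sum_eq_single (q ((g * h⁻¹) • y)), Finset.sum_eq_single (q y)]
    · rw [Set.indicator_of_mem]
      exact ⟨by simp [Set.mem_smul_set_iff_inv_smul_mem], rfl⟩
    · intro j _ hj
      exact Set.indicator_of_notMem (fun hy => hj hy.2.symm) _
    · simp
    · intro i _ hi
      refine Finset.sum_eq_zero fun j _ => Set.indicator_of_notMem (fun hy => hi ?_) _
      have := hy.1
      rw [Set.mem_smul_set_iff_inv_smul_mem] at this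
      simpa using this.symm
    · simp
  simp_rw [h1, h2]
  rw [integral_finsetSum _ fun i _ => integrable_finsetSum _ fun j _ =>
    (integrable_const _).indicator (hm i j)]
  refine Finset.sum_congr rfl fun i _ => ?_
  rw [integral_finsetSum _ fun j _ => (integrable_const _).indicator (hm i j)]
  refine Finset.sum_congr rfl fun j _ => ?_
  rw [integral_indicator_const _ (hm i j), smul_eq_mul, mul_comm]

/-! ### Mean ergodic theorem and variance estimate. -/

/-- An `L²` function that is invariant under an ergodic action is a.e. constant. -/
lemma ae_eq_const_of_forall_smul_ae_eq {Γ : Type*} [Group Γ] {X : Type*} [MeasurableSpace X]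
    [MulAction Γ X] {μ : Measure X} [ErgodicSMul Γ X μ] {f : X → ℝ}
    (hf : NullMeasurable f μ) (h : ∀ g : Γ, (fun x => f (g • x)) =ᵐ[μ] f) :
    ∃ c, f =ᵐ[μ] fun _ => c := by
  refine exists_eventuallyEq_const_of_forall_separating MeasurableSet fun U hU => ?_
  have := aeconst_of_forall_preimage_smul_ae_eq Γ (hf hU) (fun g => by
    refine ((h g).mono fun x hx => ?_).set_eq
    simp only [Set.mem_preimage] at hx ⊢
    rw [hx])
  exact Filter.eventuallyConst_set.1 this

/-- The point of least norm in a closed convex set is unique, and isometries preserving the set must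
fix it. -/
lemma exists_smul_eq_mem_closure_convexHull_orbit {G H : Type*} [Group G] [NormedAddCommGroup H]
    [InnerProductSpace ℝ H] [CompleteSpace H] [DistribMulAction G H] [SMulCommClass G ℝ H]
    [IsIsometricSMul G H] (x : H) :
    ∃ v ∈ closure (convexHull ℝ (MulAction.orbit G x)), ∀ g : G, g • v = v := by
  set K := closure (convexHull ℝ (MulAction.orbit G x)) with hK
  have hne : K.Nonempty := ⟨x, subset_closure (subset_convexHull ℝ _ (MulAction.mem_orbit_self x))⟩
  have hconv : Convex ℝ K := (convex_convexHull ℝ _).closure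
  obtain ⟨v, hvK, hv⟩ := exists_norm_eq_iInf_of_complete_convex hne isClosed_closure.isComplete
    hconv 0
  refine ⟨v, hvK, fun g => ?_⟩
  have hgK : g • v ∈ K := by
    have h1 : Set.MapsTo (fun y => g • y) (convexHull ℝ (MulAction.orbit G x))
        (convexHull ℝ (MulAction.orbit G x)) := by
      intro y hy
      have h2 : (DistribSMul.toLinearMap ℝ H g) '' (MulAction.orbit G x)
          = MulAction.orbit G x := MulAction.smul_orbit g x
      have h3 := (DistribSMul.toLinearMap ℝ H g).image_convexHull (MulAction.orbit G x)
      rw [h2] at h3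
      rw [← h3]
      exact ⟨y, hy, rfl⟩
    exact h1.closure (isometry_smul H g).continuous hvK
  have hin := (norm_eq_iInf_iff_real_inner_le_zero hconv hvK).1 hv (g • v) hgK
  have hnorm : ‖g • v‖ = ‖v‖ := by
    have := dist_smul g v 0
    simpa using this
  rw [zero_sub, inner_neg_left, inner_sub_right, real_inner_self_eq_norm_sq] at hin
  have h4 : ‖g • v - v‖ ^ 2 ≤ 0 := by
    rw [norm_sub_sq_real, hnorm, real_inner_comm]
    linarith
  have h5 : ‖g • v - v‖ = 0 := by
    have := sq_nonneg ‖g • v - v‖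
    exact pow_eq_zero_iff (two_ne_zero) |>.1 (le_antisymm h4 this)
  exact sub_eq_zero.1 (norm_eq_zero.1 h5)


/-- Mean ergodic theorem: the integral of an `L²` function is approximated in `L²` by finite
convex combinations of its translates. -/
lemma exists_integral_sq_average_sub_lt {Γ : Type*} [Group Γ] {X : Type*} [MeasurableSpace X]
    [MulAction Γ X] [MeasurableConstSMul Γ X] {μ : Measure X} [IsProbabilityMeasure μ]
    [ErgodicSMul Γ X μ] {f : X → ℝ} (hf : MemLp f 2 μ) {δ : ℝ} (hδ : 0 < δ) :
    ∃ (ι : Type) (_ : Fintype ι) (w : ι → ℝ) (g : ι → Γ), ∑ i, w i = 1 ∧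
      ∫ x, (∑ i, w i * f (g i • x) - ∫ x', f x' ∂μ) ^ 2 ∂μ < δ := by
  set m := ∫ x, f x ∂μ with hm
  set u : Lp ℝ 2 μ := hf.toLp f with hu
  obtain ⟨v, hvK, hv⟩ := exists_smul_eq_mem_closure_convexHull_orbit (G := (Γᵈᵐᵃ)) u
  obtain ⟨c, hc⟩ := ae_eq_const_of_forall_smul_ae_eq (Γ := Γ) (f := v)
    (Lp.aestronglyMeasurable v).aemeasurable.nullMeasurable fun g => by
      have h1 := DomMulAct.smul_Lp_ae_eq (DomMulAct.mk g) v
      rw [hv] at h1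
      exact h1.symm
  have hinner : ∀ a : Lp ℝ 2 μ, inner ℝ (Lp.const 2 μ (1 : ℝ)) a = ∫ x, a x ∂μ := fun a => by
    simp [L2.inner_def]
  have hvm : ∫ x, v x ∂μ = m := by
    -- The functions of mean `m` form a closed hyperplane containing the orbit, hence also `v`; this
    -- identifies the constant `c`.
    have hclosed : IsClosed {a : Lp ℝ 2 μ | inner ℝ (Lp.const 2 μ (1 : ℝ)) a = m} :=
      isClosed_eq (by fun_prop) continuous_const
    have hconv : Convex ℝ {a : Lp ℝ 2 μ | inner ℝ (Lp.const 2 μ (1 : ℝ)) a = m} :=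
      convex_hyperplane (innerₗ (Lp ℝ 2 μ) (Lp.const 2 μ (1 : ℝ))).isLinear m
    have hsub : MulAction.orbit (Γᵈᵐᵃ) u ⊆
        {a : Lp ℝ 2 μ | inner ℝ (Lp.const 2 μ (1 : ℝ)) a = m} := by
      rintro _ ⟨g, rfl⟩
      simp only [Set.mem_ofPred_eq, hinner]
      rw [integral_congr_ae (DomMulAct.smul_Lp_ae_eq g u),
        (measurePreserving_smul (DomMulAct.mk.symm g) μ).integral_comp
          (MeasurableEquiv.smul (DomMulAct.mk.symm g)).measurableEmbedding u]
      exact integral_congr_ae hf.coeFn_toLp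
    have := closure_minimal (convexHull_min hsub hconv) hclosed hvK
    rwa [Set.mem_ofPred_eq, hinner] at this
  have hcm : c = m := by
    rw [← hvm, integral_congr_ae hc]; simp
  obtain ⟨a, ha, hav⟩ := Metric.mem_closure_iff.1 hvK (√δ) (Real.sqrt_pos.2 hδ)
  obtain ⟨ι, _, w, z, -, hw, hz, rfl⟩ := mem_convexHull_iff_exists_fintype.1 ha
  choose g hg using hz
  refine ⟨ι, inferInstance, w, fun i => DomMulAct.mk.symm (g i), hw, ?_⟩
  have hzg : ∀ i, z i =ᵐ[μ] fun x => f (DomMulAct.mk.symm (g i) • x) := fun i => by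
    have h1 := DomMulAct.smul_Lp_ae_eq (g i) u
    have h2 := (measurePreserving_smul (DomMulAct.mk.symm (g i)) μ).quasiMeasurePreserving.ae_eq
      hf.coeFn_toLp
    rw [← hg i]
    exact h1.trans h2
  have hsum : (fun x => (∑ i, w i * f (DomMulAct.mk.symm (g i) • x) - m) ^ 2)
      =ᵐ[μ] fun x => inner ℝ ((∑ i, w i • z i - v : Lp ℝ 2 μ) x)
        ((∑ i, w i • z i - v : Lp ℝ 2 μ) x) := by
    filter_upwards [Lp.coeFn_sub (∑ i, w i • z i) v,
      Lp.coeFn_fun_finsetSum Finset.univ fun i => w i • z i,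
      ae_all_iff.2 hzg, ae_all_iff.2 fun i => Lp.coeFn_smul (w i) (z i), hc] with x h1 h2 h3 h4 h5
    rw [h1, Pi.sub_apply, h2, h5, hcm, real_inner_self_eq_norm_sq, Real.norm_eq_abs, sq_abs]
    simp [h3, h4]
  rw [integral_congr_ae hsum, ← L2.inner_def, real_inner_self_eq_norm_sq, ← dist_eq_norm, dist_comm]
  calc _ < √δ ^ 2 := by gcongr
    _ = δ := Real.sq_sqrt hδ.le

/-- Variance estimate: averages over invariant measures do not change under convex combinations
of translates. -/
lemma sq_integral_sub_le_integral_sq {Γ : Type*} [Group Γ] {Y : Type*} [MeasurableSpace Y]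
    [MulAction Γ Y] [MeasurableConstSMul Γ Y] {ν : Measure Y} [IsProbabilityMeasure ν]
    [SMulInvariantMeasure Γ Y ν] {f : Y → ℝ} (hf : MemLp f 2 ν) {ι : Type*} [Fintype ι]
    {w : ι → ℝ} (hw : ∑ i, w i = 1) (g : ι → Γ) (m : ℝ) :
    (∫ y, f y ∂ν - m) ^ 2 ≤ ∫ y, (∑ i, w i * f (g i • y) - m) ^ 2 ∂ν := by
  have hfg : ∀ i, MemLp (fun y => f (g i • y)) 2 ν := fun i =>
    hf.comp_measurePreserving (measurePreserving_smul (g i) ν)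
  have hL : MemLp (fun y => ∑ i, w i * f (g i • y) - m) 2 ν :=
    (memLp_finsetSum _ fun i _ => (hfg i).const_mul (w i)).sub (memLp_const m)
  have h1 : ∫ y, f y ∂ν - m = ∫ y, (∑ i, w i * f (g i • y) - m) ∂ν := by
    have h2 : ∀ i, Integrable (fun y => w i * f (g i • y)) ν := fun i =>
      ((hfg i).const_mul (w i)).integrable one_le_two
    rw [integral_sub (integrable_finsetSum _ fun i _ => h2 i) (integrable_const m),
      integral_finsetSum _ fun i _ => h2 i]
    have h3 : ∀ i, ∫ y, w i * f (g i • y) ∂ν = w i * ∫ y, f y ∂ν := fun i => by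
      rw [integral_const_mul, (measurePreserving_smul (g i) ν).integral_comp
        (MeasurableEquiv.smul (g i)).measurableEmbedding f]
    simp [h3, ← Finset.sum_mul, hw]
  rw [h1]
  exact (even_two.convexOn_pow (𝕜 := ℝ)).map_integral_le (by fun_prop) isClosed_univ (by simp)
    (hL.integrable one_le_two) hL.integrable_sq


/-! ### Integration along a kernel. -/

lemma memLp_comp_of_finite {Y ι : Type*} [MeasurableSpace Y] [MeasurableSpace ι] [Finite ι]
    [MeasurableSingletonClass ι] (ν : Measure Y) [IsFiniteMeasure ν] {q : Y → ι}
    (hq : Measurable q) (ψ : ι → ℝ) (p : ENNReal) : MemLp (fun y => ψ (q y)) p ν := by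
  obtain ⟨C, hC⟩ := (Set.finite_range fun i => ‖ψ i‖).bddAbove
  exact MemLp.of_bound ((measurable_of_finite ψ).comp hq).aestronglyMeasurable C
    (ae_of_all _ fun y => hC ⟨q y, rfl⟩)

lemma memLp_integral_kernel_comp_of_finite {Y Z ι : Type*} [MeasurableSpace Y] {mZ : MeasurableSpace Z}
    [MeasurableSpace ι] [Finite ι] [MeasurableSingletonClass ι] (η : Measure Z) [IsFiniteMeasure η]
    (κ : Kernel Z Y) [IsMarkovKernel κ] {q : Y → ι}
    (hq : Measurable q) (ψ : ι → ℝ) (p : ENNReal) :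
    MemLp (fun z => ∫ y, ψ (q y) ∂(κ z)) p η := by
  obtain ⟨C, hC⟩ := (Set.finite_range fun i => ‖ψ i‖).bddAbove
  refine MemLp.of_bound (StronglyMeasurable.integral_kernel
    ((measurable_of_finite ψ).comp hq).stronglyMeasurable).aestronglyMeasurable C
    (ae_of_all _ fun z => ?_)
  simpa using norm_integral_le_of_norm_le_const (μ := κ z) (ae_of_all _ fun y => hC ⟨q y, rfl⟩)

lemma integral_bind_kernel {Y Z : Type*} [MeasurableSpace Y] {mZ : MeasurableSpace Z} {η : Measure Z}
    {κ : Kernel Z Y} {f : Y → ℝ} (hf : Integrable f (η.bind κ)) :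
    ∫ y, f y ∂(η.bind κ) = ∫ z, ∫ y, f y ∂(κ z) ∂η := by
  rw [Measure.comp_eq_comp_const_apply] at hf ⊢
  rw [Kernel.integral_comp hf, Kernel.const_apply]

lemma integrable_integral_bind_kernel {Y Z : Type*} [MeasurableSpace Y] {mZ : MeasurableSpace Z}
    {η : Measure Z} {κ : Kernel Z Y} {f : Y → ℝ} (hf : Integrable f (η.bind κ)) :
    Integrable (fun z => ∫ y, f y ∂(κ z)) η := by
  rw [Measure.comp_eq_comp_const_apply] at hf
  exact hf.integral_comp

/-- Markov's inequality for every `n` bounds the set where all `H n` are at least `ε`; no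
subsequence is needed, since `n` may depend on `z`. -/
lemma ae_exists_lt_of_tendsto_integral {Z : Type*} {mZ : MeasurableSpace Z} {η : Measure Z}
    [IsFiniteMeasure η] {H : ℕ → Z → ℝ} (hH : ∀ n, 0 ≤ᵐ[η] H n) (hint : ∀ n, Integrable (H n) η)
    (hlim : Tendsto (fun n => ∫ z, H n z ∂η) atTop (𝓝 0)) {ε : ℝ} (hε : 0 < ε) :
    ∀ᵐ z ∂η, ∃ n, H n z < ε := by
  have h1 : ε * η.real {z | ∀ n, ε ≤ H n z} ≤ 0 := by
    refine ge_of_tendsto' hlim fun n => ?_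
    refine le_trans ?_ (mul_meas_ge_le_integral_of_nonneg (hH n) (hint n) ε)
    gcongr
    · simp
    · exact fun h => h n
  have h2 : η.real {z | ∀ n, ε ≤ H n z} = 0 :=
    le_antisymm (nonpos_of_mul_nonpos_right h1 hε) measureReal_nonneg
  rw [measureReal_eq_zero_iff] at h2
  rw [ae_iff]
  simpa using h2

/-! ### Transfer of the ergodic averages to the fibre measures. -/

section Correlation

variable {Γ : Type*} [Group Γ] {X : Type*} [MeasurableSpace X] [MulAction Γ X]
  [MeasurableConstSMul Γ X] {μ : Measure X} [IsProbabilityMeasure μ]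
  {Y : Type*} [MeasurableSpace Y] [MulAction Γ Y] [MeasurableConstSMul Γ Y]
  {ν : Measure Y} [IsProbabilityMeasure ν] [SMulInvariantMeasure Γ Y ν]
  {ι : Type*} [Fintype ι] [MeasurableSpace ι] [MeasurableSingletonClass ι]
  {p : X → ι} {q : ℕ → Y → ι}

lemma tendsto_integral_correlation [SMulInvariantMeasure Γ X μ] (hp : Measurable p)
    (hq : ∀ n, Measurable (q n))
    (hpq : ∀ (g : Γ) (i j : ι), Tendsto (fun n => ν.real ((g • (q n ⁻¹' {i})) ∩ q n ⁻¹' {j})) atTop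
      (𝓝 (μ.real ((g • (p ⁻¹' {i})) ∩ p ⁻¹' {j})))) (φ : ι → ι → ℝ) (g h : Γ) :
    Tendsto (fun n => ∫ y, φ (q n (g • y)) (q n (h • y)) ∂ν) atTop
      (𝓝 (∫ x, φ (p (g • x)) (p (h • x)) ∂μ)) := by
  simp_rw [integral_correlation ν (hq _), integral_correlation μ hp]
  exact tendsto_finsetSum _ fun i _ => tendsto_finsetSum _ fun j _ => (hpq _ i j).const_mul _

lemma integral_sq_average_sub_eq [SMulInvariantMeasure Γ X μ] (hp : Measurable p) (ψ : ι → ℝ)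
    {s : Type*} [Fintype s] {w : s → ℝ} (hw : ∑ a, w a = 1) (g : s → Γ) (m : ℝ) :
    ∫ x, (∑ a, w a * ψ (p (g a • x)) - m) ^ 2 ∂μ =
      ∑ a, ∑ b, w a * w b * ∫ x, (ψ (p (g a • x)) - m) * (ψ (p (g b • x)) - m) ∂μ := by
  have h1 : ∀ x, (∑ a, w a * ψ (p (g a • x)) - m) ^ 2 =
      ∑ a, ∑ b, w a * w b * ((ψ (p (g a • x)) - m) * (ψ (p (g b • x)) - m)) := fun x => by
    have h2 : ∑ a, w a * ψ (p (g a • x)) - m = ∑ a, w a * (ψ (p (g a • x)) - m) := by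
      simp [mul_sub, Finset.sum_sub_distrib, ← Finset.sum_mul, hw]
    rw [h2, sq, Finset.sum_mul_sum]
    exact Finset.sum_congr rfl fun a _ => Finset.sum_congr rfl fun b _ => by ring
  have h3 : ∀ a b, Integrable
      (fun x => w a * w b * ((ψ (p (g a • x)) - m) * (ψ (p (g b • x)) - m))) μ := fun a b =>
    ((memLp_comp_of_finite μ (q := fun x => (p (g a • x), p (g b • x)))
      ((hp.comp (measurable_const_smul _)).prodMk (hp.comp (measurable_const_smul _)))
      (fun c => (ψ c.1 - m) * (ψ c.2 - m)) 1).integrable le_rfl).const_mul _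
  simp_rw [h1]
  rw [integral_finsetSum _ fun a _ => integrable_finsetSum _ fun b _ => h3 a b]
  refine Finset.sum_congr rfl fun a _ => ?_
  rw [integral_finsetSum _ fun b _ => h3 a b]
  exact Finset.sum_congr rfl fun b _ => integral_const_mul _ _

variable {Z : Type*} {mZ : MeasurableSpace Z} {η : Measure Z} [IsProbabilityMeasure η]
  {κ : Kernel Z Y} [IsMarkovKernel κ]

/-- If the pair correlations of `q n` converge to those of an observable `p` of an ergodic action,
then the averages of `q n` over the invariant measures `κ z` converge in `L²` to the average
of `p`. -/
lemma tendsto_integral_sq_integral_kernel_sub [ErgodicSMul Γ X μ] (hκ : η.bind κ = ν)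
    (hinv : ∀ᵐ z ∂η, SMulInvariantMeasure Γ Y (κ z)) (hp : Measurable p)
    (hq : ∀ n, Measurable (q n))
    (hpq : ∀ (g : Γ) (i j : ι), Tendsto (fun n => ν.real ((g • (q n ⁻¹' {i})) ∩ q n ⁻¹' {j})) atTop
      (𝓝 (μ.real ((g • (p ⁻¹' {i})) ∩ p ⁻¹' {j})))) (ψ : ι → ℝ) :
    Tendsto (fun n => ∫ z, (∫ y, ψ (q n y) ∂(κ z) - ∫ x, ψ (p x) ∂μ) ^ 2 ∂η) atTop (𝓝 0) := by
  set m := ∫ x, ψ (p x) ∂μ with hm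
  refine tendsto_order.2 ⟨fun a ha => Eventually.of_forall fun n =>
    ha.trans_le (integral_nonneg fun z => sq_nonneg _), fun δ hδ => ?_⟩
  obtain ⟨s, _, w, g, hw, hlt⟩ := exists_integral_sq_average_sub_lt (Γ := Γ)
    (memLp_comp_of_finite μ hp ψ 2) hδ
  have hlim : Tendsto (fun n => ∫ y, (∑ a, w a * ψ (q n (g a • y)) - m) ^ 2 ∂ν) atTop
      (𝓝 (∫ x, (∑ a, w a * ψ (p (g a • x)) - m) ^ 2 ∂μ)) := by
    simp_rw [integral_sq_average_sub_eq (hq _) ψ hw g m, integral_sq_average_sub_eq hp ψ hw g m]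
    exact tendsto_finsetSum _ fun a _ => tendsto_finsetSum _ fun b _ =>
      (tendsto_integral_correlation hp hq hpq (fun i j => (ψ i - m) * (ψ j - m)) _ _).const_mul _
  filter_upwards [hlim.eventually_lt_const hlt] with n hn
  refine lt_of_le_of_lt ?_ hn
  have hI : Integrable (fun y => (∑ a, w a * ψ (q n (g a • y)) - m) ^ 2) (η.bind κ) := by
    rw [hκ]
    exact ((memLp_comp_of_finite ν (q := fun y a => q n (g a • y))
      (measurable_pi_lambda _ fun a => (hq n).comp (measurable_const_smul _))
      (fun c => (∑ a, w a * ψ (c a) - m) ^ 2) 1).integrable le_rfl)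
  rw [← hκ, integral_bind_kernel hI]
  refine integral_mono_ae ?_ (integrable_integral_bind_kernel hI) ?_
  · exact ((memLp_integral_kernel_comp_of_finite η κ (hq n) ψ 2).sub (memLp_const m)).integrable_sq
  · filter_upwards [hinv] with z hz
    exact sq_integral_sub_le_integral_sq (memLp_comp_of_finite _ (hq n) ψ 2) hw g m

end Correlation


/-! ### Weak containment in almost every fibre measure. -/

lemma abs_measureReal_sub_integral_le {Y : Type*} [MeasurableSpace Y] {ρ : Measure Y}
    [IsFiniteMeasure ρ] {C : Set Y} (hC : MeasurableSet C) {u v : Y → ℝ}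
    (hu : Integrable u ρ) (hv : Integrable v ρ)
    (h : ∀ y, |C.indicator 1 y - u y| ≤ v y) : |ρ.real C - ∫ y, u y ∂ρ| ≤ ∫ y, v y ∂ρ := by
  have hi : Integrable (C.indicator (1 : Y → ℝ)) ρ := (integrable_const (1 : ℝ)).indicator hC
  rw [← integral_indicator_one hC, ← integral_sub hi hu]
  exact (abs_integral_le_integral_abs).trans (integral_mono (hi.sub hu).abs hv h)

/-- The correlations of a partition form a point of a finite-dimensional real space, so the set of
attained points is separable. -/
lemma exists_countable_approx_isBorelPartition {Γ : Type*} [Group Γ] {X : Type*}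
    [MeasurableSpace X] [MulAction Γ X] (μ : Measure X) (k : ℕ) (F : Finset Γ) :
    ∃ S : Set (Fin k → Set X), S.Countable ∧ (∀ A ∈ S, IsBorelPartition A) ∧
      ∀ A, IsBorelPartition A → ∀ ε : ℝ, 0 < ε → ∃ A' ∈ S, ∀ γ ∈ F, ∀ i j,
        |μ.real ((γ • A i) ∩ A j) - μ.real ((γ • A' i) ∩ A' j)| < ε := by
  let f : (Fin k → Set X) → F → Fin k → Fin k → ℝ :=
    fun A γ i j => μ.real (((γ : Γ) • A i) ∩ A j)
  obtain ⟨c, hc, hcc, hcd⟩ := (TopologicalSpace.IsSeparable.of_separableSpace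
    (f '' {A | IsBorelPartition A})).exists_countable_dense_subset
  have hc' : ∀ v, ∃ A, v ∈ c → IsBorelPartition A ∧ f A = v := fun v => by
    by_cases hv : v ∈ c
    · obtain ⟨A, hA, hAv⟩ := hc hv
      exact ⟨A, fun _ => ⟨hA, hAv⟩⟩
    · exact ⟨fun _ => ∅, fun h => absurd h hv⟩
  choose g hg using hc'
  refine ⟨g '' c, hcc.image g, ?_, fun A hA ε hε => ?_⟩
  · rintro _ ⟨v, hv, rfl⟩
    exact (hg v hv).1
  · obtain ⟨v, hv, hd⟩ := Metric.mem_closure_iff.1 (hcd ⟨A, hA, rfl⟩) ε hε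
    refine ⟨g v, ⟨v, hv, rfl⟩, fun γ hγ i j => ?_⟩
    have h1 := (dist_pi_lt_iff hε).1 hd ⟨γ, hγ⟩
    have h2 := (dist_pi_lt_iff hε).1 ((dist_pi_lt_iff hε).1 h1 i) j
    rw [← (hg v hv).2, Real.dist_eq] at h2
    exact h2

section Disintegration

variable {Γ : Type*} [Group Γ] [Countable Γ] {X : Type*} [MeasurableSpace X] [MulAction Γ X]
  [MeasurableConstSMul Γ X] {μ : Measure X} [IsProbabilityMeasure μ]
  {Y : Type*} [MeasurableSpace Y] [MulAction Γ Y] [MeasurableConstSMul Γ Y]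
  {ν : Measure Y} [IsProbabilityMeasure ν] [SMulInvariantMeasure Γ Y ν]
  {Z : Type*} {mZ : MeasurableSpace Z} {η : Measure Z} [IsProbabilityMeasure η]
  {κ : Kernel Z Y} [IsMarkovKernel κ]

lemma ae_exists_isBorelPartition [ErgodicSMul Γ X μ] (hw : WeaklyContained Γ μ ν)
    (hκ : η.bind κ = ν) (hinv : ∀ᵐ z ∂η, SMulInvariantMeasure Γ Y (κ z))
    {k : ℕ} {A : Fin k → Set X} (hA : IsBorelPartition A) (F : Finset Γ) {ε : ℝ} (hε : 0 < ε) :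
    ∀ᵐ z ∂η, ∃ B : Fin k → Set Y, IsBorelPartition B ∧ ∀ γ ∈ F, ∀ i j : Fin k,
      |μ.real ((γ • A i) ∩ A j) - (κ z).real ((γ • B i) ∩ B j)| < ε := by
  classical
  obtain ⟨r, hr, hrA⟩ := hA.exists_measurable
  -- `ψ t ∘ p` is the indicator of `γ • A i ∩ A j` for `t = (γ, i, j)`. For a model `q n` the
  -- recorded label at `y` may differ from the actual label at `γ⁻¹ • y`; `φ t` detects a
  -- disagreement about `i`.
  let p : X → (F → Fin k) × Fin k := fun x => (fun γ => r ((γ : Γ)⁻¹ • x), r x)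
  have hp : Measurable p :=
    (measurable_pi_lambda _ fun γ => hr.comp (measurable_const_smul _)).prodMk hr
  obtain ⟨q, hq, hpq⟩ := hw.exists_seq_tendsto hp
  let T := F × Fin k × Fin k
  let ψ : T → (F → Fin k) × Fin k → ℝ := fun t a => if a.1 t.1 = t.2.1 ∧ a.2 = t.2.2 then 1 else 0
  let φ : T → (F → Fin k) × Fin k → (F → Fin k) × Fin k → ℝ :=
    fun t a b => if a.2 = t.2.1 ↔ b.1 t.1 = t.2.1 then 0 else 1
  have hφ0 : ∀ t a b, 0 ≤ φ t a b := fun t a b => by dsimp only [φ]; split_ifs <;> simp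
  have hφ1 : ∀ t a b, φ t a b ≤ 1 := fun t a b => by dsimp only [φ]; split_ifs <;> simp
  have hqq : ∀ n (γ : Γ), Measurable fun y => (q n (γ⁻¹ • y), q n y) := fun n γ =>
    ((hq n).comp (measurable_const_smul _)).prodMk (hq n)
  have hφi : ∀ (ρ : Measure Y) [IsFiniteMeasure ρ] n t,
      Integrable (fun y => φ t (q n ((t.1 : Γ)⁻¹ • y)) (q n y)) ρ := fun ρ _ n t =>
    (memLp_comp_of_finite ρ (hqq n t.1) (fun c => φ t c.1 c.2) 1).integrable le_rfl
  -- The factors 2 come from `(a + b)² ≤ 2a² + 2b²`. The mismatch integral lies in `[0, 1]`, so it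
  -- dominates its square and can enter linearly.
  let H : ℕ → Z → ℝ := fun n z => ∑ t : T, (2 * ∫ y, φ t (q n ((t.1 : Γ)⁻¹ • y)) (q n y) ∂(κ z)
    + 2 * (∫ y, ψ t (q n y) ∂(κ z) - ∫ x, ψ t (p x) ∂μ) ^ 2)
  have hterm : ∀ n t z, 0 ≤ 2 * ∫ y, φ t (q n ((t.1 : Γ)⁻¹ • y)) (q n y) ∂(κ z)
      + 2 * (∫ y, ψ t (q n y) ∂(κ z) - ∫ x, ψ t (p x) ∂μ) ^ 2 := fun n t z => by
    have : 0 ≤ ∫ y, φ t (q n ((t.1 : Γ)⁻¹ • y)) (q n y) ∂(κ z) :=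
      integral_nonneg fun y => hφ0 _ _ _
    positivity
  have hI1 : ∀ n t, Integrable (fun z => ∫ y, φ t (q n ((t.1 : Γ)⁻¹ • y)) (q n y) ∂(κ z)) η :=
    fun n t => integrable_integral_bind_kernel (by rw [hκ]; exact hφi ν n t)
  have hI2 : ∀ n t, Integrable
      (fun z => (∫ y, ψ t (q n y) ∂(κ z) - ∫ x, ψ t (p x) ∂μ) ^ 2) η := fun n t =>
    ((memLp_integral_kernel_comp_of_finite η κ (hq n) (ψ t) 2).sub (memLp_const _)).integrable_sq
  have hI : ∀ n t, Integrable (fun z => 2 * ∫ y, φ t (q n ((t.1 : Γ)⁻¹ • y)) (q n y) ∂(κ z)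
      + 2 * (∫ y, ψ t (q n y) ∂(κ z) - ∫ x, ψ t (p x) ∂μ) ^ 2) η := fun n t =>
    ((hI1 n t).const_mul 2).add ((hI2 n t).const_mul 2)
  have hlim : Tendsto (fun n => ∫ z, H n z ∂η) atTop (𝓝 0) := by
    have h1 : ∀ n, ∫ z, H n z ∂η = ∑ t : T, (2 * ∫ y, φ t (q n ((t.1 : Γ)⁻¹ • y)) (q n y) ∂ν
        + 2 * ∫ z, (∫ y, ψ t (q n y) ∂(κ z) - ∫ x, ψ t (p x) ∂μ) ^ 2 ∂η) := fun n => by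
      rw [integral_finsetSum _ fun t _ => hI n t]
      refine Finset.sum_congr rfl fun t _ => ?_
      rw [integral_add ((hI1 n t).const_mul 2) ((hI2 n t).const_mul 2), integral_const_mul,
        integral_const_mul, ← integral_bind_kernel (by rw [hκ]; exact hφi ν n t), hκ]
    have h2 : ∀ t : T, Tendsto (fun n => ∫ y, φ t (q n ((t.1 : Γ)⁻¹ • y)) (q n y) ∂ν)
        atTop (𝓝 0) := fun t => by
      -- The mismatch is a pair correlation, and it vanishes identically for `p`.
      have h3 := tendsto_integral_correlation hp hq hpq (φ t) (t.1 : Γ)⁻¹ 1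
      simpa [φ, p] using h3
    simp_rw [h1]
    simpa using tendsto_finsetSum Finset.univ fun t _ => ((h2 t).const_mul 2).add
      ((tendsto_integral_sq_integral_kernel_sub hκ hinv hp hq hpq (ψ t)).const_mul 2)
  filter_upwards [ae_exists_lt_of_tendsto_integral
    (fun n => ae_of_all _ fun z => Finset.sum_nonneg fun t _ => hterm n t z)
    (fun n => integrable_finsetSum _ fun t _ => hI n t) hlim (pow_pos hε 2)] with z ⟨n, hn⟩
  have hs : Measurable fun y => (q n y).2 := measurable_snd.comp (hq n)
  have hB := isBorelPartition_preimage_singleton hs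
  refine ⟨_, hB, fun γ hγ i j => ?_⟩
  let t : T := (⟨γ, hγ⟩, i, j)
  have hm : ∫ x, ψ t (p x) ∂μ = μ.real ((γ • A i) ∩ A j) := by
    rw [← integral_indicator_one (((hA.measurableSet i).const_smul γ).inter (hA.measurableSet j))]
    congr 1 with x
    simp [ψ, p, t, Set.indicator_apply, ← hrA, Set.mem_smul_set_iff_inv_smul_mem]
  have hle := abs_measureReal_sub_integral_le (ρ := κ z)
    (((hB.measurableSet i).const_smul γ).inter (hB.measurableSet j))
    ((memLp_comp_of_finite (κ z) (hq n) (ψ t) 1).integrable le_rfl) (hφi (κ z) n t) fun y => by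
      by_cases h1 : (q n (γ⁻¹ • y)).2 = i <;> by_cases h2 : (q n y).2 = j <;>
        by_cases h3 : (q n y).1 ⟨γ, hγ⟩ = i <;>
        simp [ψ, φ, t, Set.mem_smul_set_iff_inv_smul_mem, h1, h2, h3]
  have h1 : ∫ y, φ t (q n ((t.1 : Γ)⁻¹ • y)) (q n y) ∂(κ z) ≤ 1 := by
    simpa using integral_mono (hφi (κ z) n t) (integrable_const (1 : ℝ)) fun y => hφ1 _ _ _
  have h2 := (Finset.single_le_sum (fun t _ => hterm n t z) (Finset.mem_univ t)).trans_lt hn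
  rw [hm] at h2
  rw [abs_sub_comm]
  refine abs_lt_of_sq_lt_sq (lt_of_le_of_lt ?_ h2) hε.le
  set a := ∫ y, φ t (q n ((t.1 : Γ)⁻¹ • y)) (q n y) ∂(κ z)
  set b := ∫ y, ψ t (q n y) ∂(κ z)
  rw [abs_le] at hle
  nlinarith [sq_nonneg ((κ z).real (γ • ((fun y => (q n y).2) ⁻¹' {i}) ∩
    (fun y => (q n y).2) ⁻¹' {j}) - b - (b - μ.real ((γ • A i) ∩ A j)))]

/-- An ergodic action weakly contained in a measure preserving action is weakly contained in
almost every member of any measurable decomposition into invariant measures. -/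
lemma ae_weaklyContained_of_bind_eq [ErgodicSMul Γ X μ] (hw : WeaklyContained Γ μ ν)
    (hκ : η.bind κ = ν) (hinv : ∀ᵐ z ∂η, SMulInvariantMeasure Γ Y (κ z)) :
    ∀ᵐ z ∂η, WeaklyContained Γ μ (κ z) := by
  choose S hSc hS hSA using fun (k : ℕ) (F : Finset Γ) =>
    exists_countable_approx_isBorelPartition μ k F
  have h : ∀ᵐ z ∂η, ∀ (k : ℕ) (F : Finset Γ) (m : ℕ), ∀ A ∈ S k F,
      ∃ B : Fin k → Set Y, IsBorelPartition B ∧ ∀ γ ∈ F, ∀ i j : Fin k,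
        |μ.real ((γ • A i) ∩ A j) - (κ z).real ((γ • B i) ∩ B j)| < 1 / (m + 1 : ℝ) := by
    rw [ae_all_iff]; intro k
    rw [ae_all_iff]; intro F
    rw [ae_all_iff]; intro m
    rw [ae_ball_iff (hSc k F)]; intro A hA
    exact ae_exists_isBorelPartition hw hκ hinv (hS k F A hA) F (by positivity)
  filter_upwards [h] with z hz k A hA F ε hε
  obtain ⟨m, hm⟩ := exists_nat_one_div_lt (half_pos hε)
  obtain ⟨A', hA', hAA'⟩ := hSA k F A hA (ε / 2) (half_pos hε)
  obtain ⟨B, hB, hBA⟩ := hz k F m A' hA'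
  refine ⟨B, hB, fun γ hγ i j => ?_⟩
  have h1 := hAA' γ hγ i j
  have h2 := (hBA γ hγ i j).trans hm
  exact (abs_sub_le _ (μ.real ((γ • A' i) ∩ A' j)) _).trans_lt (by linarith)

end Disintegration

/-! ### Almost every fibre measure is invariant. -/

/-- `κ` and its image under `γ` have the same composition-product with `η`, and disintegrations into
a countably generated space are a.e. unique. -/
lemma ae_smulInvariantMeasure_of_setLIntegral_eq {Γ : Type*} [Group Γ] [Countable Γ]
    {Y : Type*} [MeasurableSpace Y] [MeasurableSpace.CountablyGenerated Y] [MulAction Γ Y]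
    [MeasurableConstSMul Γ Y] {Z : Type*} {mZ : MeasurableSpace Z} {η : Measure Z}
    [IsFiniteMeasure η] {κ : Kernel Z Y} [IsMarkovKernel κ]
    (h : ∀ (γ : Γ) (s : Set Y) (t : Set Z), MeasurableSet s → MeasurableSet t →
      ∫⁻ z in t, κ z ((γ • ·) ⁻¹' s) ∂η = ∫⁻ z in t, κ z s ∂η) :
    ∀ᵐ z ∂η, SMulInvariantMeasure Γ Y (κ z) := by
  have h1 : ∀ γ : Γ, κ.map (γ • ·) =ᵐ[η] κ := fun γ => by
    have : IsMarkovKernel (κ.map (γ • · : Y → Y)) :=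
      Kernel.IsMarkovKernel.map _ (measurable_const_smul γ)
    refine Kernel.ae_eq_of_compProd_eq (Measure.ext_prod fun {t s} ht hs => ?_)
    rw [Measure.compProd_apply_prod ht hs, Measure.compProd_apply_prod ht hs, ← h γ s t hs ht]
    simp_rw [Kernel.map_apply' _ (measurable_const_smul γ) _ hs]
  filter_upwards [ae_all_iff.2 h1] with z hz
  refine ⟨fun γ s hs => ?_⟩
  conv_rhs => rw [← hz γ]
  rw [Kernel.map_apply' _ (measurable_const_smul γ) _ hs]

lemma IsDisintegration.setLIntegral_eq {Y : Type*} [MeasurableSpace Y] {ν : Measure Y}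
    {Z : Type*} [MeasurableSpace Z] {η : Measure Z} {π : Y → Z} {κ : Kernel Z Y}
    (h : IsDisintegration ν η π κ) (hπ : Measurable π) {s : Set Y} (hs : MeasurableSet s)
    {t : Set Z} (ht : MeasurableSet t) : ∫⁻ z in t, κ z s ∂η = ν (s ∩ π ⁻¹' t) := by
  rw [h.measure_eq _ (hs.inter (hπ ht)), ← lintegral_indicator ht]
  refine lintegral_congr_ae ?_
  filter_upwards [h.ae_fibre] with z hz
  by_cases hzt : z ∈ t
  · rw [Set.indicator_of_mem hzt]
    refine measure_congr ?_
    filter_upwards [hz] with y hy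
    refine propext ⟨fun hys => ⟨hys, ?_⟩, fun hys => hys.1⟩
    rwa [Set.mem_preimage, hy]
  · rw [Set.indicator_of_notMem hzt]
    refine (measure_mono_null ?_ hz).symm
    rintro y ⟨-, hy⟩ rfl
    exact hzt hy

lemma IsFactorMap.ae_smulInvariantMeasure {Γ : Type*} [Group Γ] [Countable Γ]
    {Y : Type*} [MeasurableSpace Y] [MeasurableSpace.CountablyGenerated Y] [MulAction Γ Y]
    [MeasurableConstSMul Γ Y] {ν : Measure Y} [SMulInvariantMeasure Γ Y ν]
    {Z : Type*} [MeasurableSpace Z] [MulAction Γ Z] {η : Measure Z} [IsFiniteMeasure η]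
    {π : Y → Z} {κ : Kernel Z Y} (hid : ∀ (γ : Γ) (z : Z), γ • z = z)
    (hπ : IsFactorMap Γ ν η π) (hκ : IsDisintegration ν η π κ) :
    ∀ᵐ z ∂η, SMulInvariantMeasure Γ Y (κ z) := by
  have := hκ.isMarkovKernel
  have hπm := hπ.measurePreserving.measurable
  refine ae_smulInvariantMeasure_of_setLIntegral_eq fun γ s t hs ht => ?_
  rw [hκ.setLIntegral_eq hπm (measurable_const_smul γ hs) ht, hκ.setLIntegral_eq hπm hs ht,
    ← measure_preimage_smul γ (s ∩ π ⁻¹' t) (μ := ν)]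
  refine measure_congr ?_
  filter_upwards [hπ.ae_equivariant γ] with y hy
  rw [hid] at hy
  refine propext (and_congr Iff.rfl ?_)
  simp [hy]

/-! ### The disintegration over the invariant σ-algebra. -/

section ErgodicComponent

variable {Γ : Type*} [Group Γ] {Y : Type*} [MeasurableSpace Y] [StandardBorelSpace Y]
  [MulAction Γ Y]

lemma invariantSigmaAlgebra_le (Γ : Type*) [Group Γ] (Y : Type*) [mY : MeasurableSpace Y]
    [MulAction Γ Y] : invariantSigmaAlgebra Γ Y ≤ mY := fun _ hs => hs.1

/-- `condExpKernel ν m` is a kernel out of `(Y, m)`, so the base measure must be `ν.trim hm`. -/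
lemma setLIntegral_condExpKernel_trim {Y : Type*} {m mY : MeasurableSpace Y}
    [StandardBorelSpace Y] (ν : Measure Y) [IsFiniteMeasure ν] (hm : m ≤ mY) {s t : Set Y}
    (hs : MeasurableSet s) (ht : MeasurableSet[m] t) :
    ∫⁻ y in t, condExpKernel ν m y s ∂(ν.trim hm) = ν (t ∩ s) := by
  rw [← Measure.compProd_apply_prod ht hs, compProd_trim_condExpKernel hm]
  exact Measure.map_apply ((measurable_id'' hm).prodMk measurable_id) (ht.prod hs)

lemma ae_smulInvariantMeasure_ergodicComponent [Countable Γ] [MeasurableConstSMul Γ Y]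
    (ν : Measure Y) [IsFiniteMeasure ν] [SMulInvariantMeasure Γ Y ν] :
    ∀ᵐ y ∂(ν.trim (invariantSigmaAlgebra_le Γ Y)),
      SMulInvariantMeasure Γ Y (condExpKernel ν (invariantSigmaAlgebra Γ Y) y) := by
  refine ae_smulInvariantMeasure_of_setLIntegral_eq fun γ s t hs ht => ?_
  rw [setLIntegral_condExpKernel_trim ν _ (measurable_const_smul γ hs) ht,
    setLIntegral_condExpKernel_trim ν _ hs ht, ← measure_preimage_smul γ (t ∩ s) (μ := ν),
    Set.preimage_inter, ht.2 γ]

end ErgodicComponent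

theorem theorem3p9
    {Γ : Type*} [Group Γ] [Countable Γ]
    {X : Type*} [MeasurableSpace X] [StandardBorelSpace X] [MulAction Γ X]
    [MeasurableConstSMul Γ X] (μ : Measure X) [IsProbabilityMeasure μ]
    {Y : Type*} [MeasurableSpace Y] [StandardBorelSpace Y] [MulAction Γ Y]
    [MeasurableConstSMul Γ Y] (ν : Measure Y) [IsProbabilityMeasure ν]
    [SMulInvariantMeasure Γ Y ν]
    (ha : ErgodicSMul Γ X μ)
    (had : WeaklyContained Γ μ ν) :
    (∀ (Z : Type*) [MeasurableSpace Z] [StandardBorelSpace Z] [MulAction Γ Z]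
        (η : Measure Z) [IsProbabilityMeasure η] (π : Y → Z) (κ : Kernel Z Y),
      (∀ (γ : Γ) (z : Z), γ • z = z) → IsFactorMap Γ ν η π → IsDisintegration ν η π κ →
        ∀ᵐ z ∂η, SMulInvariantMeasure Γ Y (κ z) ∧ WeaklyContained Γ μ (κ z)) ∧
    (∀ᵐ y ∂ν, SMulInvariantMeasure Γ Y (ergodicComponent Γ ν y) ∧
      WeaklyContained Γ μ (ergodicComponent Γ ν y)) := by
  refine ⟨fun Z _ _ _ η _ π κ hid hπ hκ => ?_, ?_⟩
  · have := hκ.isMarkovKernel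
    have hinv := hπ.ae_smulInvariantMeasure hid hκ
    have hbind : η.bind κ = ν := Measure.ext fun s hs => by
      rw [Measure.bind_apply hs κ.aemeasurable, hκ.measure_eq s hs]
    exact hinv.and (ae_weaklyContained_of_bind_eq had hbind hinv)
  · have hle := invariantSigmaAlgebra_le Γ Y
    have hinv := ae_smulInvariantMeasure_ergodicComponent (Γ := Γ) ν
    have : IsProbabilityMeasure (ν.trim hle) :=
      ⟨by rw [trim_measurableSet_eq hle .univ, measure_univ]⟩
    exact ae_of_ae_trim hle
      (hinv.and (ae_weaklyContained_of_bind_eq had (condExpKernel_comp_trim hle) hinv))
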